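/- Let $V$ be a matrix ordered operator space with complete norm. Explicitly: $V$ is a complex vector space with a conjugate-linear involution $*$ (extended to $M_n(V)$ by $[x_{ij}]^*=[x_{ji}^*]$), with norms $\|\cdot\|_n$ on $M_n(V)$, $n\in\mathbb N$, satisfying Ruan's axioms $\|x\oplus y\|_{m+n}=\max\{\|x\|_m,\|y\|_n\}$ and $\|\alpha x\beta\|_n\le\|\alpha\|\,\|x\|_m\,\|\beta\|$ for scalar matrices $\alpha\in M_{n,m}$, $\beta\in M_{m,n}$, the norm $\|\cdot\|_1$ being complete, and with (not necessarily proper) convex cones $M_n(V)^+\subset M_n(V)_{sa}=\{v\in M_n(V): v=v^*\}$ such that $\alpha^*M_m(V)^+\alpha\subset M_n(V)^+$ for all $\alpha\in M_{m,n}$; moreover, for every $n$, the involution is isometric on $M_n(V)$ and $M_n(V)^+$ is $\|\cdot\|_n$-closed. Write $v\le u$ for $u-v\in M_n(V)^+$. Suppose that $V$ is matrix regular, that is, for every $n$ and every $v\in M_n(V)_{sa}$: (1) if $u\in M_n(V)^+$ and $-u\le v\le u$, then $\|v\|_n\le\|u\|_n$; (2) if $\|v\|_n<1$, then there is $u\in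 M_n(V)^+$ with $\|u\|_n<1$ and $-u\le v\le u$. For $x\in M_n(V)$ let $$\nu_V(x)=\sup\left\{\left|\varphi\begin{pmatrix}0&x\\x^*&0\end{pmatrix}\right| : \varphi\in M_{2n}(V)^*_{1,+}\right\}$$ be the modified numerical radius, where $M_{2n}(V)^*_{1,+}$ is the set of self-adjoint linear functionals $\varphi$ on $M_{2n}(V)$ (i.e. $\varphi(z^*)=\overline{\varphi(z)}$) that are nonnegative on $M_{2n}(V)^+$ and satisfy $|\varphi(z)|\le\|z\|_{2n}$ for all $z$. Then $V$ is an operator system in Werner's sense with dominating constant $2$: the cones are proper, i.e. $M_n(V)^+\cap(-M_n(V)^+)=\{0\}$ for all $n$, and $$\|x\|_n\le 2\,\nu_V(x)\qquad\text{for all } n\in\mathbb N \text{ and all } x\in M_n(V).$$ -/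

import Mathlib

open scoped Matrix

/-- `M_n(V)`, the square matrices of size `n` with entries in `V`. -/
abbrev Mat (n : ℕ) (V : Type*) : Type _ := Matrix (Fin n) (Fin n) V

/-- The product `α x β` of a matrix `x` over `V` with scalar matrices `α` and `β`. -/
def scalarSandwich {V : Type*} [AddCommMonoid V] [Module ℂ V] {m n : ℕ}
    (α : Matrix (Fin n) (Fin m) ℂ) (x : Mat m V) (β : Matrix (Fin m) (Fin n) ℂ) : Mat n V :=
  Matrix.of fun i j => ∑ k, ∑ l, (α i k * β l j) • x k l

/-- The block matrix `[a, b; c, d]` in `M_{m+n}(V)`. -/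
def blockMat {V : Type*} {m n : ℕ} (a : Mat m V) (b : Matrix (Fin m) (Fin n) V)
    (c : Matrix (Fin n) (Fin m) V) (d : Mat n V) : Mat (m + n) V :=
  Matrix.reindex finSumFinEquiv finSumFinEquiv (Matrix.fromBlocks a b c d)

section OperatorSpaceDef

open scoped Matrix.Norms.L2Operator

/-- A (not necessarily complete) operator space: a complex normed space with norms on all the
spaces `M_n(V)` that satisfy Ruan's axioms.  The norm of a scalar matrix is its operator norm
between Euclidean spaces. -/
class OperatorSpace (V : Type*) [NormedAddCommGroup V] [NormedSpace ℂ V] where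
  /-- The norm `‖·‖_n` on `M_n(V)`. -/
  matNorm : ∀ n : ℕ, Seminorm ℂ (Mat n V)
  eq_zero_of_matNorm_eq_zero : ∀ (n : ℕ) (x : Mat n V), matNorm n x = 0 → x = 0
  matNorm_one : ∀ v : V, matNorm 1 (Matrix.of fun _ _ => v) = ‖v‖
  matNorm_directSum : ∀ (m n : ℕ) (x : Mat m V) (y : Mat n V),
    matNorm (m + n) (blockMat x 0 0 y) = max (matNorm m x) (matNorm n y)
  matNorm_sandwich_le : ∀ (m n : ℕ) (α : Matrix (Fin n) (Fin m) ℂ) (x : Mat m V)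
    (β : Matrix (Fin m) (Fin n) ℂ),
    matNorm n (scalarSandwich α x β) ≤ ‖α‖ * matNorm m x * ‖β‖

end OperatorSpaceDef

/-- A matrix ordered space: a complex `*`-vector space with (not necessarily proper) cones
`M_n(V)⁺` of self-adjoint matrices such that `α* M_m(V)⁺ α ⊆ M_n(V)⁺` for all scalar
`m × n` matrices `α`.  The involution on `M_n(V)` is the conjugate transpose. -/
class MatrixOrderedSpace (V : Type*) [AddCommGroup V] [Module ℂ V] [StarAddMonoid V]
    [StarModule ℂ V] where
  /-- The positive cone `M_n(V)⁺`. -/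
  matCone : ∀ n : ℕ, Set (Mat n V)
  isHermitian_of_mem : ∀ (n : ℕ) (x : Mat n V), x ∈ matCone n → x.IsHermitian
  zero_mem : ∀ n : ℕ, (0 : Mat n V) ∈ matCone n
  add_mem : ∀ (n : ℕ) (x y : Mat n V), x ∈ matCone n → y ∈ matCone n → x + y ∈ matCone n
  smul_mem : ∀ (n : ℕ) (t : ℝ) (x : Mat n V), 0 ≤ t → x ∈ matCone n → (t : ℂ) • x ∈ matCone n
  sandwich_mem : ∀ (m n : ℕ) (α : Matrix (Fin m) (Fin n) ℂ) (x : Mat m V),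
    x ∈ matCone m → scalarSandwich αᴴ x α ∈ matCone n

open OperatorSpace MatrixOrderedSpace

/-- A matrix ordered operator space: the involution is isometric on each `M_n(V)`, and each
`M_n(V)⁺` is closed for the norm `‖·‖_n`. -/
class MatrixOrderedOperatorSpace (V : Type*) [NormedAddCommGroup V] [NormedSpace ℂ V]
    [StarAddMonoid V] [StarModule ℂ V] [OperatorSpace V] [MatrixOrderedSpace V] : Prop where
  matNorm_conjTranspose : ∀ (n : ℕ) (x : Mat n V), matNorm n xᴴ = matNorm n x
  matCone_closed : ∀ (n : ℕ) (x : Mat n V),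
    (∀ ε : ℝ, 0 < ε → ∃ y ∈ (matCone n : Set (Mat n V)), matNorm n (x - y) < ε) → x ∈ matCone n

section Order

variable {V : Type*} [AddCommGroup V] [Module ℂ V] [StarAddMonoid V] [StarModule ℂ V]
  [MatrixOrderedSpace V]

/-- The order `x ≤ y` on `M_n(V)` given by the cone `M_n(V)⁺`. -/
def MatLE {n : ℕ} (x y : Mat n V) : Prop := y - x ∈ (matCone n : Set (Mat n V))

variable (V) in
/-- The cones are proper: `M_n(V)⁺ ∩ -M_n(V)⁺ = {0}` for all `n`. -/
def HasProperCones : Prop :=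
  ∀ (n : ℕ) (x : Mat n V), x ∈ (matCone n : Set (Mat n V)) →
    -x ∈ (matCone n : Set (Mat n V)) → x = 0

end Order

section Regular

variable (V : Type*) [NormedAddCommGroup V] [NormedSpace ℂ V] [StarAddMonoid V] [StarModule ℂ V]
  [OperatorSpace V] [MatrixOrderedSpace V]

/-- A matrix regular operator space (the underlying object being a matrix ordered operator
space): the norm is complete, and the two order conditions hold on all `M_n(V)_sa`. -/
structure IsMatrixRegular [MatrixOrderedOperatorSpace V] : Prop where
  complete : CompleteSpace V
  norm_le_of_between : ∀ (n : ℕ) (v u : Mat n V), v.IsHermitian →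
    u ∈ (matCone n : Set (Mat n V)) → MatLE (-u) v → MatLE v u → matNorm n v ≤ matNorm n u
  exists_between : ∀ (n : ℕ) (v : Mat n V), v.IsHermitian → matNorm n v < 1 →
    ∃ u ∈ (matCone n : Set (Mat n V)), matNorm n u < 1 ∧ MatLE (-u) v ∧ MatLE v u

variable {V}

/-- The set `M_m(V)^*_{1,+}` of positive functionals of norm at most one on `M_m(V)`.  As always
for the cone of a matrix ordered dual, positive functionals are self-adjoint by definition
(which is automatic when the positive cone spans, as in a matrix regular operator space). -/
structure IsPositiveContraction {m : ℕ} (φ : Mat m V →ₗ[ℂ] ℂ) : Prop where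
  map_conjTranspose : ∀ z : Mat m V, φ zᴴ = star (φ z)
  nonneg : ∀ p ∈ (matCone m : Set (Mat m V)), 0 ≤ (φ p).re ∧ (φ p).im = 0
  contractive : ∀ z : Mat m V, ‖φ z‖ ≤ matNorm m z

/-- The modified numerical radius `ν(x)`: the supremum of `|φ([0, x; x*, 0])|` over all
`φ ∈ M_{2n}(V)^*_{1,+}`. -/
noncomputable def modifiedNumericalRadius {n : ℕ} (x : Mat n V) : ℝ :=
  sSup {r : ℝ | ∃ φ : Mat (n + n) V →ₗ[ℂ] ℂ,
    IsPositiveContraction φ ∧ r = ‖φ (blockMat 0 x xᴴ 0)‖}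

/-- The supremum defining `ν(x)` is over a nonempty set that is bounded above. -/
theorem modifiedNumericalRadius_wellDefined {n : ℕ} (x : Mat n V) :
    {r : ℝ | ∃ φ : Mat (n + n) V →ₗ[ℂ] ℂ,
      IsPositiveContraction φ ∧ r = ‖φ (blockMat 0 x xᴴ 0)‖}.Nonempty ∧
    BddAbove {r : ℝ | ∃ φ : Mat (n + n) V →ₗ[ℂ] ℂ,
      IsPositiveContraction φ ∧ r = ‖φ (blockMat 0 x xᴴ 0)‖} := by
  refine ⟨⟨0, 0, ⟨by simp, by simp, fun z => by simp⟩, by simp⟩,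
    ⟨matNorm (n + n) (blockMat 0 x xᴴ 0), ?_⟩⟩
  rintro r ⟨φ, hφ, rfl⟩
  exact hφ.contractive _

variable (V)

/-- The matrix ordered operator space `V` is an operator system in Werner's sense with
dominating constant `k`. -/
structure IsOperatorSystemWithConstant [MatrixOrderedOperatorSpace V] (k : ℝ) : Prop where
  pos : 0 < k
  proper : HasProperCones V
  norm_le : ∀ (n : ℕ) (x : Mat n V), matNorm n x ≤ k * modifiedNumericalRadius x

end Regular

/-! The element `x` is a corner of the self-adjoint block matrix `[0, x; x*, 0]`, so it suffices to
bound the norm of a self-adjoint `y` by `2 s`, where `s` bounds `‖φ y‖` over positive contractive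
`φ`. The tool is the sublinear functional `coneDist`, the distance from the real part to the
negative cone. By Hahn-Banach its value at `y` is attained by a positive contraction
(`exists_isPositiveContraction_re_eq`), so its values at `y` and `-y` are at most `s`. The second
regularity axiom turns this into positive `u ≥ y` and `w ≥ -y` of norm barely above `s`. Then `-(u +
w) ≤ y ≤ u + w`, and the first axiom gives `‖y‖ ≤ ‖u‖ + ‖w‖`; the constant 2 counts these two
bounds. Properness is the first axiom with bound `0`. -/

section ScalarNorm

open scoped Matrix.Norms.L2Operator

theorem Matrix.l2_opNorm_le_one_of_mul_conjTranspose_eq_one {m n : ℕ}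
    (α : Matrix (Fin n) (Fin m) ℂ) (h : α * αᴴ = 1) : ‖α‖ ≤ 1 := by
  have h1 : ‖αᴴ‖ * ‖αᴴ‖ = ‖(1 : Matrix (Fin n) (Fin n) ℂ)‖ := by
    rw [← Matrix.l2_opNorm_conjTranspose_mul_self, Matrix.conjTranspose_conjTranspose, h]
  have h2 : ‖(1 : Matrix (Fin n) (Fin n) ℂ)‖ ≤ 1 := by
    -- For `n = 0` the identity is `0` and has norm `0`, hence only an inequality.
    rcases subsingleton_or_nontrivial (Matrix (Fin n) (Fin n) ℂ) with hs | hs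
    · rw [Subsingleton.elim (1 : Matrix (Fin n) (Fin n) ℂ) 0, norm_zero]
      exact zero_le_one
    · exact CStarRing.norm_one.le
  rw [Matrix.l2_opNorm_conjTranspose] at h1
  nlinarith [norm_nonneg α]

theorem Matrix.l2_opNorm_le_one_of_conjTranspose_mul_eq_one {m n : ℕ}
    (α : Matrix (Fin n) (Fin m) ℂ) (h : αᴴ * α = 1) : ‖α‖ ≤ 1 := by
  rw [← Matrix.l2_opNorm_conjTranspose]
  exact l2_opNorm_le_one_of_mul_conjTranspose_eq_one _
    (by rwa [Matrix.conjTranspose_conjTranspose])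

/-- The norm of a corner of a block matrix is at most the norm of the matrix. -/
theorem OperatorSpace.matNorm_corner_le {V : Type*} [NormedAddCommGroup V] [NormedSpace ℂ V]
    [OperatorSpace V] {n : ℕ} (a b c d : Mat n V) :
    matNorm n b ≤ matNorm (n + n) (blockMat a b c d) := by
  -- The row `[1, 0]` and the column `[0; 1]` cut out the upper right corner; both are contractions.
  let α : Matrix (Fin n) (Fin (n + n)) ℂ :=
    Matrix.of fun i => Fin.addCases (fun j => if i = j then 1 else 0) (fun _ => 0)
  let β : Matrix (Fin (n + n)) (Fin n) ℂ :=
    Matrix.of fun k j => Fin.addCases (fun _ => 0) (fun i => if i = j then 1 else 0) k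
  have hα : ‖α‖ ≤ 1 := by
    apply Matrix.l2_opNorm_le_one_of_mul_conjTranspose_eq_one
    ext i j
    simp [α, Matrix.mul_apply, Fin.sum_univ_add, Matrix.one_apply, -Fin.natAdd_eq_addNat]
  have hβ : ‖β‖ ≤ 1 := by
    apply Matrix.l2_opNorm_le_one_of_conjTranspose_mul_eq_one
    ext i j
    simp [β, Matrix.mul_apply, Fin.sum_univ_add, Matrix.one_apply, eq_comm, -Fin.natAdd_eq_addNat]
  have hb : scalarSandwich α (blockMat a b c d) β = b := by
    ext i j
    simp [scalarSandwich, α, β, blockMat, Fin.sum_univ_add, ite_smul, -Fin.natAdd_eq_addNat]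
  calc matNorm n b = matNorm n (scalarSandwich α (blockMat a b c d) β) := by rw [hb]
    _ ≤ ‖α‖ * matNorm (n + n) (blockMat a b c d) * ‖β‖ := matNorm_sandwich_le _ _ _ _ _
    _ ≤ 1 * matNorm (n + n) (blockMat a b c d) * 1 := by gcongr
    _ = _ := by ring

end ScalarNorm

/-! ### Hahn-Banach and real-linear preliminaries. -/

theorem blockMat_offDiag_isHermitian {V : Type*} [AddMonoid V] [StarAddMonoid V] {n : ℕ}
    (x : Mat n V) : (blockMat 0 x xᴴ 0).IsHermitian := by
  unfold Matrix.IsHermitian blockMat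
  rw [Matrix.conjTranspose_reindex, Matrix.fromBlocks_conjTranspose]
  simp

/-- A sublinear functional on a real vector space dominates a linear functional that agrees with
it at a given point. -/
theorem exists_linear_le_sublinear_eq {E : Type*} [AddCommGroup E] [Module ℝ E] (N : E → ℝ)
    (hsmul : ∀ c : ℝ, 0 < c → ∀ x, N (c • x) = c * N x)
    (hadd : ∀ x y, N (x + y) ≤ N x + N y) (x : E) :
    ∃ g : E →ₗ[ℝ] ℝ, g x = N x ∧ ∀ y, g y ≤ N y := by
  have h0 : N 0 = 0 := by
    have := hsmul 2 two_pos 0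
    rw [smul_zero] at this
    linarith
  rcases eq_or_ne x 0 with rfl | hx
  · obtain ⟨g, -, hg⟩ := exists_extension_of_le_sublinear (⟨⊥, 0⟩ : E →ₗ.[ℝ] ℝ) N hsmul hadd
      (by rintro ⟨y, hy⟩; obtain rfl := (Submodule.mem_bot ℝ).1 hy; simp [h0])
    exact ⟨g, by rw [map_zero, h0], hg⟩
  · obtain ⟨g, hgx, hg⟩ := exists_extension_of_le_sublinear
      (LinearPMap.mkSpanSingleton x (N x) hx : E →ₗ.[ℝ] ℝ) N hsmul hadd (by
        rintro ⟨y, hy⟩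
        obtain ⟨c, rfl⟩ := Submodule.mem_span_singleton.1 hy
        rw [LinearPMap.mkSpanSingleton'_apply, RingHom.id_apply, smul_eq_mul]
        rcases lt_trichotomy c 0 with hc | rfl | hc
        -- For `c < 0`, `0 = N 0 ≤ N (c • x) + N (-c • x) = N (c • x) - c * N x`.
        · have h1 := hadd (c • x) ((-c) • x)
          rw [← add_smul, add_neg_cancel, zero_smul, h0, hsmul (-c) (neg_pos.2 hc)] at h1
          linarith
        · simp [h0]
        · exact (hsmul c hc x).ge)
    refine ⟨g, ?_, hg⟩
    have hmem : x ∈ Submodule.span ℝ {x} := Submodule.mem_span_singleton_self x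
    rw [hgx ⟨x, hmem⟩]
    exact LinearPMap.mkSpanSingleton_apply ℝ ℝ hx (N x)

theorem OperatorSpace.matNorm_real_smul {V : Type*} [NormedAddCommGroup V] [NormedSpace ℂ V]
    [OperatorSpace V] {m : ℕ} (c : ℝ) (x : Mat m V) :
    matNorm m (c • x) = |c| * matNorm m x := by
  have : c • x = (c : ℂ) • x := by ext i j; simp
  rw [this, map_smul_eq_mul]
  simp

theorem MatrixOrderedSpace.real_smul_mem {V : Type*} [AddCommGroup V] [Module ℂ V]
    [StarAddMonoid V] [StarModule ℂ V] [MatrixOrderedSpace V] {m : ℕ} {c : ℝ} (hc : 0 ≤ c) {x : Mat m V}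
    (hx : x ∈ (matCone m : Set (Mat m V))) : c • x ∈ (matCone m : Set (Mat m V)) := by
  have : c • x = (c : ℂ) • x := by ext i j; simp
  rw [this]
  exact smul_mem m c x hc hx

theorem half_smul_add_conjTranspose {V : Type*} [AddCommGroup V] [Module ℝ V] [StarAddMonoid V]
    {m : ℕ} {x : Mat m V} (hx : x.IsHermitian) :
    (2⁻¹ : ℝ) • (x + xᴴ) = x := by
  rw [hx.eq]
  module

theorem conjTranspose_real_smul {V : Type*} [AddCommGroup V] [Module ℂ V] [StarAddMonoid V]
    [StarModule ℂ V] {m : ℕ} (c : ℝ) (z : Mat m V) : (c • z)ᴴ = c • zᴴ := by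
  ext i j
  have (v : V) : star (c • v) = c • star v := by
    rw [← Complex.coe_smul c v, star_smul]
    simp
  simp [this]

theorem conjTranspose_I_smul {V : Type*} [AddCommGroup V] [Module ℂ V] [StarAddMonoid V]
    [StarModule ℂ V] {m : ℕ} (z : Mat m V) : (Complex.I • z)ᴴ = -(Complex.I • zᴴ) := by
  ext i j
  simp [star_smul]

/-! ### Distance to the negative cone, and bounds from positive functionals. -/

section Functionals

variable {V : Type*} [NormedAddCommGroup V] [NormedSpace ℂ V] [StarAddMonoid V] [StarModule ℂ V]
  [OperatorSpace V] [MatrixOrderedSpace V]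
  {m : ℕ}

/-- The distance from the real part of `z` to the negative of the positive cone. -/
noncomputable def coneDist (z : Mat m V) : ℝ :=
  ⨅ p : (matCone m : Set (Mat m V)), matNorm m ((2⁻¹ : ℝ) • (z + zᴴ) + p.1)

theorem coneDist_le (z : Mat m V) {p : Mat m V} (hp : p ∈ (matCone m : Set (Mat m V))) :
    coneDist z ≤ matNorm m ((2⁻¹ : ℝ) • (z + zᴴ) + p) :=
  ciInf_le ⟨0, by rintro _ ⟨q, rfl⟩; exact apply_nonneg (matNorm m) _⟩
    (⟨p, hp⟩ : (matCone m : Set (Mat m V)))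

theorem exists_lt_of_coneDist_lt {z : Mat m V} {r : ℝ} (h : coneDist z < r) :
    ∃ p ∈ (matCone m : Set (Mat m V)), matNorm m ((2⁻¹ : ℝ) • (z + zᴴ) + p) < r := by
  have : Nonempty (matCone m : Set (Mat m V)) := ⟨⟨0, zero_mem m⟩⟩
  obtain ⟨⟨p, hp⟩, h⟩ := exists_lt_of_ciInf_lt h
  exact ⟨p, hp, h⟩

theorem coneDist_add_le (x y : Mat m V) : coneDist (x + y) ≤ coneDist x + coneDist y := by
  refine le_of_forall_pos_lt_add fun ε hε => ?_
  obtain ⟨p, hp, hp'⟩ := exists_lt_of_coneDist_lt (lt_add_of_pos_right (coneDist x) (half_pos hε))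
  obtain ⟨q, hq, hq'⟩ := exists_lt_of_coneDist_lt (lt_add_of_pos_right (coneDist y) (half_pos hε))
  have h1 := coneDist_le (x + y) (add_mem m p q hp hq)
  have h2 : (2⁻¹ : ℝ) • (x + y + (x + y)ᴴ) + (p + q)
      = ((2⁻¹ : ℝ) • (x + xᴴ) + p) + ((2⁻¹ : ℝ) • (y + yᴴ) + q) := by
    rw [Matrix.conjTranspose_add]
    module
  rw [h2] at h1
  linarith [map_add_le_add (matNorm m) ((2⁻¹ : ℝ) • (x + xᴴ) + p) ((2⁻¹ : ℝ) • (y + yᴴ) + q)]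

theorem coneDist_smul_le {c : ℝ} (hc : 0 < c) (x : Mat m V) :
    coneDist (c • x) ≤ c * coneDist x := by
  refine le_of_forall_pos_lt_add fun ε hε => ?_
  obtain ⟨p, hp, hp'⟩ := exists_lt_of_coneDist_lt (lt_add_of_pos_right (coneDist x) (div_pos hε hc))
  have h1 := coneDist_le (c • x) (real_smul_mem hc.le hp)
  have h2 : (2⁻¹ : ℝ) • (c • x + (c • x)ᴴ) + c • p = c • ((2⁻¹ : ℝ) • (x + xᴴ) + p) := by
    rw [conjTranspose_real_smul]
    module
  rw [h2, matNorm_real_smul, abs_of_pos hc] at h1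
  have h3 := mul_lt_mul_of_pos_left hp' hc
  rw [mul_add, mul_div_cancel₀ _ hc.ne'] at h3
  exact h1.trans_lt h3

theorem coneDist_smul {c : ℝ} (hc : 0 < c) (x : Mat m V) :
    coneDist (c • x) = c * coneDist x := by
  refine le_antisymm (coneDist_smul_le hc x) ?_
  have h := coneDist_smul_le (inv_pos.2 hc) (c • x)
  rw [inv_smul_smul₀ hc.ne'] at h
  calc c * coneDist x ≤ c * (c⁻¹ * coneDist (c • x)) := by gcongr
    _ = coneDist (c • x) := mul_inv_cancel_left₀ hc.ne' _

/-- This makes every real functional dominated by `coneDist` nonnegative on the cone. -/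
theorem coneDist_neg_nonpos {p : Mat m V} (hp : p ∈ (matCone m : Set (Mat m V))) :
    coneDist (-p) ≤ 0 := by
  have h := coneDist_le (-p) hp
  rwa [half_smul_add_conjTranspose (isHermitian_of_mem m p hp).neg, neg_add_cancel,
    map_zero] at h

/-- The real part of `z` is zero. Used for `z` and `-z`, this makes dominated functionals vanish on
skew elements. -/
theorem coneDist_nonpos_of_conjTranspose_eq_neg {z : Mat m V} (hz : zᴴ = -z) :
    coneDist z ≤ 0 := by
  have h := coneDist_le z (zero_mem m)
  rwa [hz, add_neg_cancel, smul_zero, add_zero, map_zero] at h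

theorem coneDist_le_matNorm [MatrixOrderedOperatorSpace V] (z : Mat m V) :
    coneDist z ≤ matNorm m z := by
  have h := coneDist_le z (zero_mem m)
  rw [add_zero, matNorm_real_smul, abs_of_pos (by norm_num)] at h
  have h2 := map_add_le_add (matNorm m) z zᴴ
  rw [MatrixOrderedOperatorSpace.matNorm_conjTranspose] at h2
  linarith

/-- The distance from the real part of `x` to the negative of the positive cone is attained by a
positive contractive functional. -/
theorem exists_isPositiveContraction_re_eq [MatrixOrderedOperatorSpace V] (x : Mat m V) :
    ∃ φ : Mat m V →ₗ[ℂ] ℂ, IsPositiveContraction φ ∧ (φ x).re = coneDist x := by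
  obtain ⟨g, hgx, hg⟩ := exists_linear_le_sublinear_eq (coneDist (V := V) (m := m))
    (fun c hc y => coneDist_smul hc y) coneDist_add_le x
  have hskew (z : Mat m V) (hz : zᴴ = -z) : g z = 0 := by
    have h1 := (hg z).trans (coneDist_nonpos_of_conjTranspose_eq_neg hz)
    have h2 := (hg (-z)).trans (coneDist_nonpos_of_conjTranspose_eq_neg (z := -z)
      (by rw [Matrix.conjTranspose_neg, hz]))
    rw [map_neg] at h2
    linarith
  have hstar (z : Mat m V) : g zᴴ = g z := by
    have := hskew (zᴴ - z) (by simp)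
    rw [map_sub] at this
    linarith
  -- The complex-linear functional with real part `g`: `φ z = g z - i g (i z)`.
  let φ : Mat m V →ₗ[ℂ] ℂ :=
    { toFun := fun z => ⟨g z, -g (Complex.I • z)⟩
      map_add' := fun y z => by
        apply Complex.ext <;> simp [add_comm]
      map_smul' := fun c z => by
        have h1 : c • z = c.re • z + c.im • (Complex.I • z) := by
          conv_lhs => rw [← Complex.re_add_im c]
          rw [add_smul, mul_smul]
          ext i j; simp
        have h2 : Complex.I • (c • z) = c.re • (Complex.I • z) - c.im • z := by
          rw [h1, smul_add, smul_comm Complex.I c.re, smul_comm Complex.I c.im, smul_smul,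
            Complex.I_mul_I, neg_one_smul, smul_neg, sub_eq_add_neg]
        apply Complex.ext
        · simp only [h1, map_add, map_smul, smul_eq_mul, RingHom.id_apply, Complex.mul_re]
          ring
        · simp only [h2, map_sub, map_smul, smul_eq_mul, RingHom.id_apply, Complex.mul_im]
          ring }
  have hre (z : Mat m V) : (φ z).re = g z := rfl
  have him (z : Mat m V) : (φ z).im = -g (Complex.I • z) := rfl
  have hconj (z : Mat m V) : φ zᴴ = star (φ z) := by
    apply Complex.ext
    · rw [hre, hstar]; rfl
    · have : Complex.I • zᴴ = -(Complex.I • z)ᴴ := by rw [conjTranspose_I_smul, neg_neg]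
      rw [him, this, map_neg, hstar, ← him]
      rfl
  refine ⟨φ, ⟨hconj, fun p hp => ⟨?_, ?_⟩, fun z => ?_⟩, hgx⟩
  · have h := (hg (-p)).trans (coneDist_neg_nonpos hp)
    rw [map_neg] at h
    rw [hre]
    linarith
  · have h := congrArg Complex.im (hconj p)
    rw [(isHermitian_of_mem m p hp).eq] at h
    simp at h
    linarith
  · rcases eq_or_ne (φ z) 0 with h0 | h0
    · rw [h0, norm_zero]
      exact apply_nonneg _ _
    · have hn : (‖φ z‖ : ℂ) ≠ 0 := by simpa using h0
      -- Rotating `z` by a phase makes `φ` real and nonnegative there, so the bound on `g` suffices.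
      let c : ℂ := star (φ z) / ‖φ z‖
      have hc : ‖c‖ = 1 := by simp [c, h0]
      have hφ : φ (c • z) = ‖φ z‖ := by
        rw [map_smul, smul_eq_mul, div_mul_eq_mul_div, div_eq_iff hn]
        simpa [sq] using Complex.conj_mul' (φ z)
      calc ‖φ z‖ = g (c • z) := by rw [← hre, hφ, Complex.ofReal_re]
        _ ≤ matNorm m (c • z) := (hg _).trans (coneDist_le_matNorm _)
        _ = matNorm m z := by rw [map_smul_eq_mul, hc, one_mul]

/-- In a matrix regular space, a self-adjoint `x` at distance less than `r` from the negative of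
the positive cone is bounded above by a positive element of norm less than `r`. -/
theorem IsMatrixRegular.exists_le_of_coneDist_lt [MatrixOrderedOperatorSpace V]
    (hV : IsMatrixRegular V) {x : Mat m V} (hx : x.IsHermitian) {r : ℝ} (hr : 0 < r)
    (h : coneDist x < r) :
    ∃ u ∈ (matCone m : Set (Mat m V)), matNorm m u < r ∧ MatLE x u := by
  obtain ⟨p, hp, hlt⟩ := exists_lt_of_coneDist_lt h
  rw [half_smul_add_conjTranspose hx] at hlt
  have hherm : (r⁻¹ • (x + p))ᴴ = r⁻¹ • (x + p) := by
    rw [conjTranspose_real_smul, (hx.add (isHermitian_of_mem m p hp)).eq]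
  -- Scaling by `r⁻¹` puts `x + p` in the open unit ball; a bound for `x + p` also bounds `x`, as
  -- `p` is positive.
  obtain ⟨u, hu, hu1, -, hle⟩ := hV.exists_between m (r⁻¹ • (x + p)) hherm (by
    rw [matNorm_real_smul, abs_of_pos (inv_pos.2 hr)]
    exact (inv_mul_lt_one₀ hr).2 hlt)
  refine ⟨r • u, real_smul_mem hr.le hu, ?_, ?_⟩
  · rw [matNorm_real_smul, abs_of_pos hr]
    exact mul_lt_of_lt_one_right hr hu1
  · have h3 := add_mem m _ _ (real_smul_mem hr.le hle) hp
    rw [smul_sub, smul_inv_smul₀ hr.ne'] at h3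
    have h4 : r • u - (x + p) + p = r • u - x := by abel
    rw [h4] at h3
    exact h3

/-- In a matrix regular space, the norm of a self-adjoint element is at most twice the supremum
of its values under positive contractive functionals. -/
theorem IsMatrixRegular.matNorm_le_two_mul [MatrixOrderedOperatorSpace V]
    (hV : IsMatrixRegular V) {x : Mat m V} (hx : x.IsHermitian) {s : ℝ}
    (hs : ∀ φ : Mat m V →ₗ[ℂ] ℂ, IsPositiveContraction φ → ‖φ x‖ ≤ s) :
    matNorm m x ≤ 2 * s := by
  have hs0 : 0 ≤ s := by
    obtain ⟨φ, hφ, -⟩ := exists_isPositiveContraction_re_eq x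
    exact (norm_nonneg _).trans (hs φ hφ)
  have h1 : coneDist x ≤ s := by
    obtain ⟨φ, hφ, h⟩ := exists_isPositiveContraction_re_eq x
    exact h ▸ (Complex.re_le_norm _).trans (hs φ hφ)
  have h2 : coneDist (-x) ≤ s := by
    obtain ⟨φ, hφ, h⟩ := exists_isPositiveContraction_re_eq (-x)
    refine h ▸ (Complex.re_le_norm _).trans ?_
    rw [map_neg, norm_neg]
    exact hs φ hφ
  refine le_of_forall_pos_lt_add fun ε hε => ?_
  have hr : s < s + ε / 2 := lt_add_of_pos_right s (half_pos hε)
  obtain ⟨u, hu, hun, hxu⟩ :=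
    hV.exists_le_of_coneDist_lt hx (hs0.trans_lt hr) (h1.trans_lt hr)
  obtain ⟨w, hw, hwn, hxw⟩ :=
    hV.exists_le_of_coneDist_lt hx.neg (hs0.trans_lt hr) (h2.trans_lt hr)
  -- The order chain is `-(u + w) ≤ -w ≤ x ≤ u ≤ u + w`.
  have hle := hV.norm_le_of_between m x (u + w) hx (add_mem m u w hu hw)
    (by
      have := add_mem m _ _ hxw hu
      have e : w - -x + u = x - -(u + w) := by abel
      rwa [e] at this)
    (by
      have := add_mem m _ _ hxu hw
      have e : u - x + w = u + w - x := by abel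
      rwa [e] at this)
  linarith [map_add_le_add (matNorm m) u w]

end Functionals

theorem mainTheorem3 {V : Type*} [NormedAddCommGroup V] [NormedSpace ℂ V] [StarAddMonoid V]
    [StarModule ℂ V] [OperatorSpace V] [MatrixOrderedSpace V] [MatrixOrderedOperatorSpace V]
    (hV : IsMatrixRegular V) : IsOperatorSystemWithConstant V 2 := by
  refine ⟨two_pos, fun n x hx hx' => ?_, fun n x => ?_⟩
  · apply eq_zero_of_matNorm_eq_zero n x
    refine le_antisymm ?_ (apply_nonneg _ _)
    rw [← map_zero (matNorm (V := V) n)]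
    refine hV.norm_le_of_between n x 0 (isHermitian_of_mem n x hx) (zero_mem n) ?_ ?_
    · simpa [MatLE] using hx
    · simpa [MatLE] using hx'
  · exact (matNorm_corner_le 0 x xᴴ 0).trans <|
      hV.matNorm_le_two_mul (blockMat_offDiag_isHermitian x) fun φ hφ =>
        le_csSup (modifiedNumericalRadius_wellDefined x).2 ⟨φ, hφ, rfl⟩
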